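/- **Symbolic games.** A symbolic game structure $\mathcal G=\langle \mathcal V,\mathcal X,\mathcal Y,\theta_\exists,\rho_\exists,\varphi\rangle$ consists of a finite set $\mathcal V$ of Boolean variables, input variables $\mathcal X\subseteq\mathcal V$, output variables $\mathcal Y=\mathcal V\setminus\mathcal X$, an initial assertion $\theta_\exists$ over $\mathcal V$, a transition assertion $\rho_\exists$ over unprimed and primed copies of $\mathcal V$, and an LTL winning condition $\varphi$ over $\mathcal V$. Let $\Sigma,\Sigma_{\mathcal X},\Sigma_{\mathcal Y}$ be the sets of valuations of $\mathcal V,\mathcal X,\mathcal Y$. From a node $s\in\Sigma$ the universal player picks $s_{\mathcal X}\in\Sigma_{\mathcal X}$; then, at $(s,s_{\mathcal X})$, the existential player picks $s_{\mathcal Y}\in\Sigma_{\mathcal Y}$ with $(s,(s_{\mathcal X},s_{\mathcal Y}))\models\rho_\exists$, and the play continues from $(s_{\mathcal X},s_{\mathcal Y})\in\Sigma$. The existential player wins a play if it is infinite and its sequence of nodes of $\Sigma$ satisfies $\varphi$ (so she loses if she cannot move). $W_\exists\subseteq\Sigma$ is the set of nodes from which she has a (history-dependent) winning strategy. **Winning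 condition and colors.** Assume that $\varphi$ is (equivalent to) an Emerson-Lei formula, that is, a finite Boolean combination of atoms $\mathsf{Inf}\,\psi:=GF\psi$ with $\psi$ a Boolean formula over $\mathcal V$; $\mathsf{Fin}\,\psi$ abbreviates $\neg\mathsf{Inf}\,\psi$. Let the set of colors $C$ consist of all Boolean formulas over $\mathcal V$ that are subformulas of this Emerson-Lei formula, and color $s\in\Sigma$ by $\gamma(s)=\{\psi\in C\mid s\models\psi\}$. For $D\subseteq C$, $D\models\varphi$ is defined inductively from $D\models\mathsf{Inf}\,\psi\Leftrightarrow\psi\in D$. **Zielonka tree.** $\mathcal Z_\varphi=(T,R,l)$ is the tree whose root $r$ has label $l(r)=C$ and in which each vertex $t$ has exactly one child labeled $D$ for each $D$ that is maximal in $\{D'\subsetneq l(t)\mid D'\models\varphi\Leftrightarrow l(t)\not\models\varphi\}$. $R(t)$ is the set of children of $t$, and $s\le t$ means that $s$ is an ancestor of $t$ or $s=t$. A vertex $t$ is winning if $l(t)\models\varphi$, and losing otherwise. Fix any total order on $T$ that extends $\le$ (the root comes first), and number the vertices accordingly. For $s<t$ put $\mathsf{anc}^s_t=\{v\in\Sigma\mid\gamma(v)\subseteq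 l(s),\ \gamma(v)\not\subseteq l(s_t)\}$, where $s_t$ is the child of $s$ with $s_t\le t$, and put $\mathsf{anc}^t_t=\{v\in\Sigma\mid\gamma(v)\subseteq l(t)\}$. **Equation system.** For $S\subseteq\Sigma$ let $$\mathsf{CPre}(S)=\{v\in\Sigma\mid\forall s_{\mathcal X}\in\Sigma_{\mathcal X}\,\exists s_{\mathcal Y}\in\Sigma_{\mathcal Y}.\ (s_{\mathcal X},s_{\mathcal Y})\in S\text{ and }(v,(s_{\mathcal X},s_{\mathcal Y}))\models\rho_\exists\}.$$ The system $S_\varphi$ has, for each $s\in T$, the equation $$X_s=_{\eta_s}\begin{cases}\bigcup_{t\in R(s)}X_t & R(s)\neq\emptyset,\ s\text{ losing}\\ \bigcap_{t\in R(s)}X_t & R(s)\neq\emptyset,\ s\text{ winning}\\ \bigcup_{s'\le s}\bigl(\mathsf{anc}^{s'}_s\cap\mathsf{CPre}(X_{s'})\bigr) & R(s)=\emptyset,\end{cases}$$ with $\eta_s=\mathsf{GFP}$ if $s$ is winning and $\eta_s=\mathsf{LFP}$ if $s$ is losing. The solution $[\![X_i]\!]$ of a system $X_i=_{\eta_i}f_i(X_1,\dots,X_k)$,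 $1\le i\le k$, of monotone equations over $\mathcal P(\Sigma)$ is the set of $v\in\Sigma$ such that the existential player wins from $(v,i)$ in the following fixpoint game. From $(v,i)$ she moves to some $(A_1,\dots,A_k)\in\mathcal P(\Sigma)^k$ with $v\in f_i(A_1,\dots,A_k)$; from $(A_1,\dots,A_k)$ the universal player moves to some $(w,j)$ with $w\in A_j$; a player who cannot move loses; and an infinite play is won by the existential player if and only if the equation of minimal index among those visited infinitely often is a $\mathsf{GFP}$ equation. **Lemma.** The winning region is the solution of the root variable: $W_\exists=[\![X_r]\!]$. -/

import Mathlib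

/-! ### Boolean formulas and LTL -/

/-- `BForm α`: finite Boolean formulas over atoms from `α`, i.e. `𝔹(α)`. -/
inductive BForm (α : Type*) : Type _
  | tt : BForm α
  | ff : BForm α
  | atom : α → BForm α
  | neg : BForm α → BForm α
  | conj : BForm α → BForm α → BForm α
  | disj : BForm α → BForm α → BForm α

/-- Truth of a Boolean formula when `P` is the set of true atoms. -/
def BForm.Sat {α : Type*} (P : Set α) : BForm α → Prop
  | .tt => True
  | .ff => False
  | .atom a => a ∈ P
  | .neg φ => ¬ φ.Sat P
  | .conj φ ψ => φ.Sat P ∧ ψ.Sat P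
  | .disj φ ψ => φ.Sat P ∨ ψ.Sat P

/-- Syntax of linear temporal logic over the atomic propositions `AP`. -/
inductive LTL (AP : Type*) : Type _
  | tt : LTL AP
  | ff : LTL AP
  | atom : AP → LTL AP
  | neg : LTL AP → LTL AP
  | conj : LTL AP → LTL AP → LTL AP
  | disj : LTL AP → LTL AP → LTL AP
  | next : LTL AP → LTL AP
  | until : LTL AP → LTL AP → LTL AP
  | finally : LTL AP → LTL AP
  | globally : LTL AP → LTL AP

/-- `φ.Sat w i`: the infinite word `w` of valuations satisfies `φ` at position `i`. -/
def LTL.Sat {AP : Type*} (w : ℕ → AP → Bool) : LTL AP → ℕ → Prop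
  | .tt, _ => True
  | .ff, _ => False
  | .atom p, i => w i p = true
  | .neg φ, i => ¬ LTL.Sat w φ i
  | .conj φ ψ, i => LTL.Sat w φ i ∧ LTL.Sat w ψ i
  | .disj φ ψ, i => LTL.Sat w φ i ∨ LTL.Sat w ψ i
  | .next φ, i => LTL.Sat w φ (i + 1)
  | .until φ ψ, i => ∃ j, i ≤ j ∧ LTL.Sat w ψ j ∧ ∀ l, i ≤ l → l < j → LTL.Sat w φ l
  | .finally φ, i => ∃ j, i ≤ j ∧ LTL.Sat w φ j
  | .globally φ, i => ∀ j, i ≤ j → LTL.Sat w φ j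

/-- The set of subformulas of an LTL formula (including the formula itself). -/
def LTL.subformulas {AP : Type*} : LTL AP → Set (LTL AP)
  | .tt => {.tt}
  | .ff => {.ff}
  | .atom p => {.atom p}
  | .neg φ => insert (.neg φ) φ.subformulas
  | .conj φ ψ => insert (.conj φ ψ) (φ.subformulas ∪ ψ.subformulas)
  | .disj φ ψ => insert (.disj φ ψ) (φ.subformulas ∪ ψ.subformulas)
  | .next φ => insert (.next φ) φ.subformulas
  | .until φ ψ => insert (.until φ ψ) (φ.subformulas ∪ ψ.subformulas)
  | .finally φ => insert (.finally φ) φ.subformulas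
  | .globally φ => insert (.globally φ) φ.subformulas

/-- A Boolean formula read as an LTL formula. -/
def BForm.toLTL {AP : Type*} : BForm AP → LTL AP
  | .tt => .tt
  | .ff => .ff
  | .atom p => .atom p
  | .neg φ => .neg φ.toLTL
  | .conj φ ψ => .conj φ.toLTL ψ.toLTL
  | .disj φ ψ => .disj φ.toLTL ψ.toLTL

/-- Emerson-Lei formulas over the colors `Col`: Boolean formulas whose atom `c` stands for `Inf c`;
`Fin c` abbreviates `¬ Inf c`. A set `D` of colors satisfies `φ` if `φ.Sat D`. -/
abbrev ELFormula (Col : Type*) : Type _ := BForm Col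

/-- An Emerson-Lei formula whose colors are Boolean formulas, as an LTL formula, where
`Inf ψ` is `G F ψ`. -/
def elToLTL {AP : Type*} : ELFormula (BForm AP) → LTL AP
  | .tt => .tt
  | .ff => .ff
  | .atom ψ => .globally (.finally ψ.toLTL)
  | .neg φ => .neg (elToLTL φ)
  | .conj φ₁ φ₂ => .conj (elToLTL φ₁) (elToLTL φ₂)
  | .disj φ₁ φ₂ => .disj (elToLTL φ₁) (elToLTL φ₂)

/-- The colors of `φ`: all Boolean formulas that are subformulas of `φ`. -/
def boolSubformulas {AP : Type*} (φ : ELFormula (BForm AP)) : Set (BForm AP) :=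
  {ψ | ψ.toLTL ∈ (elToLTL φ).subformulas}

/-! ### Games -/

/-- A game arena on the nodes `N`; the nodes outside `exist` belong to the universal player. -/
structure Arena (N : Type*) where
  exist : Set N
  move : N → N → Prop

namespace Arena

variable {N : Type*}

/-- The finite sequence `π 0, …, π i`. -/
def history (π : ℕ → N) (i : ℕ) : List N := (List.range (i + 1)).map π

/-- The step of `π` from position `i` to `i + 1` is a move and, at an existential node, the one
chosen by the strategy `σ`. -/
def CompliantStep (A : Arena N) (σ : List N → N) (π : ℕ → N) (i : ℕ) : Prop :=
  A.move (π i) (π (i + 1)) ∧ (π i ∈ A.exist → π (i + 1) = σ (history π i))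

/-- `σ` (read on nonempty histories that end in an existential node) is winning for the existential
player from `v`: after every finite compliant play that ends in an existential node, `σ` gives
a legal move, and all infinite compliant plays are in the objective `α`.
So a player who is to move and cannot loses. -/
def WinningFrom (A : Arena N) (α : Set (ℕ → N)) (σ : List N → N) (v : N) : Prop :=
  (∀ (π : ℕ → N) (n : ℕ), π 0 = v → (∀ i < n, A.CompliantStep σ π i) → π n ∈ A.exist →
      A.move (π n) (σ (history π n))) ∧
  (∀ π : ℕ → N, π 0 = v → (∀ i, A.CompliantStep σ π i) → π ∈ α)

/-- The set of nodes that are winning for the existential player. -/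
def winningRegion (A : Arena N) (α : Set (ℕ → N)) : Set N :=
  {v | ∃ σ : List N → N, A.WinningFrom α σ v}

end Arena

/-! ### Hierarchical systems of fixpoint equations -/

inductive FixKind : Type
  | lfp
  | gfp

/-- A system of `k` equations `X i =_{kind i} rhs i (X 0, …, X (k-1))` over the subsets of `N`,
with monotone right-hand sides. -/
structure FixSystem (N : Type*) (k : ℕ) where
  kind : Fin k → FixKind
  rhs : Fin k → (Fin k → Set N) → Set N
  mono : ∀ i, Monotone (rhs i)

namespace FixSystem

variable {N : Type*} {k : ℕ}

/-- The arena of the fixpoint game: from `(v, i)` the existential player moves to a tuple `A` with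
`v ∈ rhs i A`, and from `A` the universal player moves to some `(v, i)` with `v ∈ A i`. -/
def arena (S : FixSystem N k) : Arena ((N × Fin k) ⊕ (Fin k → Set N)) where
  exist := Set.range Sum.inl
  move
    | .inl (v, i), .inr A => v ∈ S.rhs i A
    | .inr A, .inl (v, i) => v ∈ A i
    | _, _ => False

/-- Equation `i` is evaluated infinitely often in `π`. -/
def InfOften (π : ℕ → (N × Fin k) ⊕ (Fin k → Set N)) (i : Fin k) : Prop :=
  ∀ n, ∃ m, n ≤ m ∧ ∃ v, π m = .inl (v, i)

/-- The equation of minimal index among those that are evaluated infinitely often is a greatest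
fixpoint equation. -/
def objective (S : FixSystem N k) : Set (ℕ → (N × Fin k) ⊕ (Fin k → Set N)) :=
  {π | ∃ i, InfOften π i ∧ (∀ j, InfOften π j → i ≤ j) ∧ S.kind i = .gfp}

/-- The solution of the variable `X i`. -/
def solution (S : FixSystem N k) (i : Fin k) : Set N :=
  {v | .inl (v, i) ∈ S.arena.winningRegion S.objective}

end FixSystem

/-! ### Zielonka trees -/

section Zielonka

variable {Col : Type*}

/-- `D` labels a child of a vertex labeled `L`: it is maximal among the proper subsets of `L` whose
satisfaction of `φ` differs from that of `L`. -/
def IsChildLabel (φ : ELFormula Col) (L D : Set Col) : Prop :=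
  Maximal (fun D' => D' ⊂ L ∧ (φ.Sat D' ↔ ¬ φ.Sat L)) D

/-- The vertices of the Zielonka tree, each given as the list of the labels on the way from
the vertex (head of the list) up to the root (last entry, `C`). -/
inductive IsZVertex (φ : ELFormula Col) (C : Set Col) : List (Set Col) → Prop
  | root : IsZVertex φ C [C]
  | child {p : List (Set Col)} {D : Set Col} :
      IsZVertex φ C p → IsChildLabel φ (p.headD ∅) D → IsZVertex φ C (D :: p)

/-- The vertex set `T` of the Zielonka tree of `φ` over the colors `C`. -/
def ZVertex (φ : ELFormula Col) (C : Set Col) : Type _ := {p : List (Set Col) // IsZVertex φ C p}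

namespace ZVertex

variable {φ : ELFormula Col} {C : Set Col}

/-- The root. -/
def root (φ : ELFormula Col) (C : Set Col) : ZVertex φ C := ⟨[C], .root⟩

/-- The label `l(t)`. -/
def label (t : ZVertex φ C) : Set Col := t.1.headD ∅

/-- `s.Anc t`: `s` is an ancestor of `t` or `t` itself, `s ≤ t`. -/
def Anc (s t : ZVertex φ C) : Prop := s.1 <:+ t.1

/-- The set `R(s)` of child vertices of `s`. -/
def children (s : ZVertex φ C) : Set (ZVertex φ C) := {t | ∃ D, t.1 = D :: s.1}

/-- Winning vertices of the tree; the others are losing. -/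
def Winning (t : ZVertex φ C) : Prop := φ.Sat t.label

/-- The set `anc^s_t` for `s ≤ t`: the nodes `v` with `γ v ⊆ l(s)` and `γ v ⊄ l(s_t)`, where `s_t`
is the child of `s` that leads to `t`. If `s = t` there is no such child, and only the first
condition remains. -/
def anchor {N : Type*} (γ : N → Set Col) (s t : ZVertex φ C) : Set N :=
  {v | γ v ⊆ s.label ∧ ∀ u ∈ s.children, u.Anc t → ¬ γ v ⊆ u.label}

open Classical in
/-- The right-hand side of the equation for `X_s`. -/
noncomputable def rhs {N : Type*} (γ : N → Set Col) (cpre : Set N →o Set N) (s : ZVertex φ C)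
    (X : ZVertex φ C → Set N) : Set N :=
  if s.children = ∅ then ⋃ s' ∈ {s' : ZVertex φ C | s'.Anc s}, anchor γ s' s ∩ cpre (X s')
  else if s.Winning then ⋂ t ∈ s.children, X t
  else ⋃ t ∈ s.children, X t

open Classical in
/-- The fixpoint kind of the equation for `X_s`. -/
noncomputable def kind (s : ZVertex φ C) : FixKind := if s.Winning then .gfp else .lfp

theorem rhs_mono {N : Type*} (γ : N → Set Col) (cpre : Set N →o Set N) (s : ZVertex φ C) :
    Monotone (rhs γ cpre s) := by
  intro X Y h
  unfold rhs
  split_ifs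
  · exact Set.iUnion₂_mono fun s' _ => Set.inter_subset_inter_right _ (cpre.monotone (h s'))
  · exact Set.iInter₂_mono fun t _ => h t
  · exact Set.iUnion₂_mono fun t _ => h t

end ZVertex

/-- The Emerson-Lei equation system, for a numbering `e` of the vertices of the Zielonka tree, a
coloring `γ` of the nodes and a controllable predecessor function `cpre`. -/
noncomputable def elSystem {N : Type*} {k : ℕ} {φ : ELFormula Col} {C : Set Col}
    (e : ZVertex φ C ≃ Fin k) (γ : N → Set Col) (cpre : Set N →o Set N) : FixSystem N k where
  kind i := (e.symm i).kind
  rhs i A := (e.symm i).rhs γ cpre (fun t => A (e t))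
  mono i _ _ h := ZVertex.rhs_mono γ cpre (e.symm i) fun t => h (e t)

end Zielonka

/-! ### Symbolic game structures -/

/-- A symbolic game structure over the Boolean variables `Var`, with input variables `inputs`.
The transition relation is an assertion over unprimed (`Sum.inl`) and primed (`Sum.inr`) copies
of the variables. -/
structure SymbolicGame (Var : Type*) where
  inputs : Set Var
  init : BForm Var
  trans : BForm (Var ⊕ Var)
  win : LTL Var

namespace SymbolicGame

variable {Var : Type*}

/-- The output variables. -/
def outputs (G : SymbolicGame Var) : Set Var := G.inputsᶜ

/-- The valuations of the input variables. -/
abbrev In (G : SymbolicGame Var) : Type _ := G.inputs → Bool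

/-- The valuations of the output variables. -/
abbrev Out (G : SymbolicGame Var) : Type _ := G.outputs → Bool

open Classical in
/-- The node given by an input and an output valuation. -/
noncomputable def join (G : SymbolicGame Var) (x : G.In) (y : G.Out) : Var → Bool :=
  fun v => if h : v ∈ G.inputs then x ⟨v, h⟩ else y ⟨v, h⟩

/-- A node (valuation) satisfies an assertion. -/
def NodeSat (s : Var → Bool) (ψ : BForm Var) : Prop := ψ.Sat {v | s v = true}

/-- `(s, s') ⊨ ρ`. -/
def Trans (G : SymbolicGame Var) (s s' : Var → Bool) : Prop :=
  G.trans.Sat {v | Sum.elim s s' v = true}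

/-- The arena of `G`: the universal player moves from a node `s` to `(s, x)` for an input `x`,
then the existential player moves to `(x, y)` for a possible output `y`. -/
def arena (G : SymbolicGame Var) : Arena ((Var → Bool) ⊕ ((Var → Bool) × G.In)) where
  exist := Set.range Sum.inr
  move
    | .inl s, .inr (s', _) => s' = s
    | .inr (s, x), .inl s' => ∃ y : G.Out, s' = G.join x y ∧ G.Trans s s'
    | _, _ => False

/-- Plays that start in a universal node and whose sequence of universal nodes satisfies the winning
condition; the intermediate existential nodes are ignored. -/
def objective (G : SymbolicGame Var) : Set (ℕ → (Var → Bool) ⊕ ((Var → Bool) × G.In)) :=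
  {π | ∃ w : ℕ → Var → Bool, (∀ n, π (2 * n) = .inl (w n)) ∧ G.win.Sat w 0}

/-- The set of nodes (valuations of all variables) that are winning for the existential player. -/
def winningRegion (G : SymbolicGame Var) : Set (Var → Bool) :=
  {s | .inl s ∈ G.arena.winningRegion G.objective}

/-- The symbolic controllable predecessor: for each input there is an output such that the resulting
node is in `S` and is a successor. -/
def cpre (G : SymbolicGame Var) : Set (Var → Bool) →o Set (Var → Bool) where
  toFun S := {s | ∀ x : G.In, ∃ y : G.Out, G.join x y ∈ S ∧ G.Trans s (G.join x y)}
  monotone' _ _ h _ hs x := (hs x).imp fun _ hy => ⟨h hy.1, hy.2⟩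

end SymbolicGame

/-- The coloring of nodes by the formulas of `C` that they satisfy. -/
def coloring {Var : Type*} (C : Set (BForm Var)) (s : Var → Bool) : Set (BForm Var) :=
  {ψ ∈ C | SymbolicGame.NodeSat s ψ}

/-!
Consider an infinite play of the fixpoint game of the Emerson-Lei system. Its vertices descend in
the Zielonka tree from a vertex to a child and return from a leaf `t` to the ancestor `s` for
which the current node lies in `anc^s_t`. The vertices seen infinitely often have a least one,
`r`, an ancestor of all vertices from some point on; hence the colors seen infinitely often all
belong to the label of `r`. Each time the play leaves the subtree of a child of `r`, it sees a
color outside the label of that child. So if all children of `r` are visited infinitely often, the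
colors seen infinitely often are not contained in the label of any child, and by maximality of
these labels they satisfy `φ` if and only if `r` is winning.

The existential player chooses the children at losing vertices. If she rotates through them while
she plays a winning strategy of the symbolic game at the leaves, then `r` cannot be losing.
Conversely, the universal player chooses the children at winning vertices. Letting him rotate
through them turns a winning strategy in the fixpoint game, which ensures that `r` is winning,
into a strategy in the symbolic game, since the node only changes at leaves.
-/

open Filter

universe u

section Subsequences

variable {X : Type*} {p : ℕ → Prop} {a : ℕ → X}

theorem frequently_of_rank_lt {ρ : ℕ → ℕ} (h : ∀ i, ¬ p i → ρ (i + 1) < ρ i) :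
    ∃ᶠ i in atTop, p i := by
  intro hp
  obtain ⟨n, hn⟩ := eventually_atTop.1 hp
  exact not_strictAnti_of_wellFoundedLT (fun i => ρ (n + i))
    (strictAnti_nat_of_succ_lt fun i => h _ (hn _ (Nat.le_add_right n i)))

theorem nth_strictMono_of_frequently (hp : ∃ᶠ i in atTop, p i) : StrictMono (Nat.nth p) :=
  Nat.nth_strictMono (Nat.frequently_atTop_iff_infinite.1 hp)

theorem nth_mem_of_frequently (hp : ∃ᶠ i in atTop, p i) (n : ℕ) : p (Nat.nth p n) :=
  Nat.nth_mem_of_infinite (Nat.frequently_atTop_iff_infinite.1 hp) n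

theorem count_nth_of_frequently [DecidablePred p] (hp : ∃ᶠ i in atTop, p i) (n : ℕ) :
    Nat.count p (Nat.nth p n) = n :=
  Nat.count_nth_of_infinite (Nat.frequently_atTop_iff_infinite.1 hp) n

theorem apply_nth_count [DecidablePred p] (hp : ∃ᶠ i in atTop, p i)
    (ha : ∀ i, ¬ p i → a (i + 1) = a i) (i : ℕ) : a (Nat.nth p (Nat.count p i)) = a i := by
  suffices key : ∀ j, i ≤ j → j ≤ Nat.nth p (Nat.count p i) → a j = a i from
    key _ (Nat.le_nth_count (Nat.frequently_atTop_iff_infinite.1 hp) i) le_rfl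
  intro j hij
  induction j, hij using Nat.le_induction with
  | base => exact fun _ => rfl
  | succ j hij ih =>
    intro hj
    have hpj : ¬ p j := fun hpj => by
      have := (nth_strictMono_of_frequently hp).monotone (Nat.count_monotone p hij)
      rw [Nat.nth_count hpj] at this
      omega
    rw [ha j hpj, ih (by omega)]

theorem apply_nth_zero (hp : ∃ᶠ i in atTop, p i) (ha : ∀ i, ¬ p i → a (i + 1) = a i) :
    a (Nat.nth p 0) = a 0 := by
  classical
  simpa only [Nat.count_zero] using apply_nth_count hp ha 0

theorem apply_nth_succ (hp : ∃ᶠ i in atTop, p i) (ha : ∀ i, ¬ p i → a (i + 1) = a i) (n : ℕ) :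
    a (Nat.nth p (n + 1)) = a (Nat.nth p n + 1) := by
  classical
  rw [← apply_nth_count hp ha (Nat.nth p n + 1), Nat.count_succ,
    if_pos (nth_mem_of_frequently hp n), count_nth_of_frequently hp]

theorem frequently_apply_nth_iff (hp : ∃ᶠ i in atTop, p i) (ha : ∀ i, ¬ p i → a (i + 1) = a i)
    (q : X → Prop) : (∃ᶠ n in atTop, q (a (Nat.nth p n))) ↔ ∃ᶠ i in atTop, q (a i) := by
  classical
  refine ⟨fun h => (nth_strictMono_of_frequently hp).tendsto_atTop.frequently h, fun h => ?_⟩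
  refine frequently_atTop.2 fun b => ?_
  obtain ⟨i, hi, hq⟩ := frequently_atTop.1 h (Nat.nth p b)
  refine ⟨Nat.count p i, ?_, by rwa [apply_nth_count hp ha]⟩
  rw [← count_nth_of_frequently hp b]
  exact Nat.count_monotone p hi

end Subsequences

section Rotation

variable {T : Type*}

theorem exists_seq_frequently_eq {S : Set T} (hS : S.Countable) (hne : S.Nonempty) :
    ∃ g : ℕ → T, (∀ n, g n ∈ S) ∧ ∀ t ∈ S, ∃ᶠ n in atTop, g n = t := by
  obtain ⟨g, rfl⟩ := hS.exists_eq_range hne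
  refine ⟨fun n => g n.unpair.1, fun n => ⟨_, rfl⟩, ?_⟩
  rintro _ ⟨m, rfl⟩
  exact frequently_atTop.2 fun n => ⟨Nat.pair m n, Nat.right_le_pair m n, by simp⟩

theorem eventually_frequently_eq [Finite T] (s : ℕ → T) :
    ∀ᶠ i in atTop, ∃ᶠ j in atTop, s j = s i := by
  have h : ∀ t, ∀ᶠ i in atTop, s i = t → ∃ᶠ j in atTop, s j = t := fun t => by
    by_cases ht : ∃ᶠ j in atTop, s j = t
    · exact .of_forall fun _ _ => ht
    · exact (not_frequently.1 ht).mono fun _ hne heq => (hne heq).elim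
  exact (eventually_all.2 h).mono fun i hi => hi (s i) rfl

theorem exists_isLeast_frequently [LinearOrder T] [Finite T] (s : ℕ → T) :
    ∃ i, IsLeast {i | ∃ᶠ n in atTop, s n = i} i := by
  obtain ⟨n, hn⟩ := (eventually_frequently_eq s).exists
  exact Set.exists_min_image _ id (Set.toFinite _) ⟨s n, hn⟩

theorem frequently_of_rotation [DecidableEq T] {s : ℕ → T} {f : ℕ → T} {r t : T}
    (hr : ∃ᶠ i in atTop, s i = r)
    (hf : ∀ i, s i = r → s (i + 1) = f (Nat.count (s · = r) i)) (ht : ∃ᶠ n in atTop, f n = t) :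
    ∃ᶠ i in atTop, s i = t := by
  refine (tendsto_add_atTop_nat 1).frequently
    ((nth_strictMono_of_frequently hr).tendsto_atTop.frequently (ht.mono fun n hn => ?_))
  rw [hf _ (nth_mem_of_frequently hr n), count_nth_of_frequently hr, hn]

theorem count_eq_nat_count [DecidableEq T] {s : ℕ → T} {l : ℕ → List T} (h0 : l 0 = [])
    (hl : ∀ i, l (i + 1) = s i :: l i) (r : T) (i : ℕ) :
    (l i).count r = Nat.count (s · = r) i := by
  induction i with
  | zero => simp [h0]
  | succ i ih => simp [hl, List.count_cons, Nat.count_succ, ih]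

end Rotation

/-! ### Forcing games -/

/-- A game in which the existential player decides the moves up to a choice of her opponent: from
`p` she can force the next position into `S` if and only if `p ∈ force S`. It abstracts from who
moves and how many intermediate nodes a round has, so that it describes single moves of an arena as
well as whole rounds of a symbolic game or of a fixpoint game. -/
structure ForcingGame (P : Type u) where
  force : Set P →o Set P
  objective : Set (ℕ → P)

namespace ForcingGame

variable {P Q : Type u}

/-- A winning strategy from `p` with a set of memory states, each of which determines the current
position. The update `next` is nondeterministic: the universal player resolves the choice among
the successors. -/
structure Strategy (G : ForcingGame P) (p : P) where
  Memory : Type u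
  pos : Memory → P
  next : Memory → Memory → Prop
  start : Memory
  pos_start : pos start = p
  forces : ∀ m, pos m ∈ G.force (pos '' {m' | next m m'})
  wins : ∀ μ : ℕ → Memory, μ 0 = start → (∀ n, next (μ n) (μ (n + 1))) → pos ∘ μ ∈ G.objective

/-- The set of positions from which the existential player has a winning strategy. -/
def winningRegion (G : ForcingGame P) : Set P := {p | Nonempty (G.Strategy p)}

end ForcingGame

namespace Arena

variable {N : Type u} {A : Arena N} {α : Set (ℕ → N)} {σ : List N → N} {v : N}

theorem history_succ (π : ℕ → N) (i : ℕ) : history π (i + 1) = history π i ++ [π (i + 1)] := by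
  simp [history, List.range_succ (n := i + 1)]

theorem history_congr {π π' : ℕ → N} {i : ℕ} (h : ∀ j ≤ i, π j = π' j) :
    history π i = history π' i :=
  List.map_congr_left fun j hj => h j (Nat.le_of_lt_succ (List.mem_range.1 hj))

theorem CompliantStep.congr {π π' : ℕ → N} {i : ℕ} (h : ∀ j ≤ i + 1, π j = π' j)
    (hc : A.CompliantStep σ π i) : A.CompliantStep σ π' i := by
  unfold CompliantStep at *
  rwa [← h i (Nat.le_succ i), ← h (i + 1) le_rfl,
    ← history_congr fun j hj => h j (hj.trans (Nat.le_succ i))]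

/-- The game on the nodes of an arena whose rounds are the single moves. -/
def forcingGame (A : Arena N) (α : Set (ℕ → N)) : ForcingGame N where
  force :=
    { toFun := fun S => {v | (v ∈ A.exist → ∃ w ∈ S, A.move v w) ∧
        (v ∉ A.exist → ∀ w, A.move v w → w ∈ S)}
      monotone' := fun _ _ h _ hv =>
        ⟨fun hx => (hv.1 hx).imp fun _ hw => ⟨h hw.1, hw.2⟩, fun hx w hw => h (hv.2 hx w hw)⟩ }
  objective := α

/-- A finite play `play 0, …, play length` that complies with `σ`. The later values of `play` are
irrelevant. -/
structure PartialPlay (A : Arena N) (σ : List N → N) (v : N) where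
  play : ℕ → N
  length : ℕ
  play_zero : play 0 = v
  compliant : ∀ i < length, A.CompliantStep σ play i

namespace PartialPlay

/-- The node in which a partial play ends. -/
def last (p : A.PartialPlay σ v) : N := p.play p.length

/-- `q` is `p` followed by one more node. -/
def ExtendsTo (p q : A.PartialPlay σ v) : Prop :=
  q.length = p.length + 1 ∧ ∀ i ≤ p.length, q.play i = p.play i

theorem exists_extendsTo (p : A.PartialPlay σ v) {w : N} (hw : A.move p.last w)
    (hσ : p.last ∈ A.exist → w = σ (history p.play p.length)) :
    ∃ q, p.ExtendsTo q ∧ q.last = w := by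
  have agree : ∀ i ≤ p.length, p.play i = Function.update p.play (p.length + 1) w i :=
    fun i hi => (Function.update_of_ne (by omega) ..).symm
  refine ⟨⟨Function.update p.play (p.length + 1) w, p.length + 1, ?_, fun i hi => ?_⟩,
    ⟨rfl, fun i hi => (agree i hi).symm⟩, Function.update_self ..⟩
  · rw [← agree 0 (Nat.zero_le _), p.play_zero]
  · rcases Nat.lt_succ_iff_lt_or_eq.1 hi with hi | rfl
    · exact (p.compliant i hi).congr fun j hj => agree j (by omega)
    · unfold CompliantStep
      rw [← agree _ le_rfl, Function.update_self, ← history_congr agree]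
      exact ⟨hw, hσ⟩

theorem play_eq_of_chain {μ : ℕ → A.PartialPlay σ v} (h0 : (μ 0).length = 0)
    (hμ : ∀ n, (μ n).ExtendsTo (μ (n + 1))) (n : ℕ) :
    (μ n).length = n ∧ ∀ i ≤ n, (μ n).play i = (μ i).last := by
  induction n with
  | zero => exact ⟨h0, fun i hi => by rw [Nat.le_zero.1 hi, last, h0]⟩
  | succ n ih =>
    have hlen : (μ (n + 1)).length = n + 1 := by rw [(hμ n).1, ih.1]
    refine ⟨hlen, fun i hi => ?_⟩
    rcases Nat.le_succ_iff.1 hi with hi | rfl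
    · rw [(hμ n).2 i (by rwa [ih.1]), ih.2 i hi]
    · rw [last, hlen]

theorem compliantStep_last_of_chain {μ : ℕ → A.PartialPlay σ v} (h0 : (μ 0).length = 0)
    (hμ : ∀ n, (μ n).ExtendsTo (μ (n + 1))) (i : ℕ) :
    A.CompliantStep σ (fun n => (μ n).last) i := by
  obtain ⟨hlen, hplay⟩ := play_eq_of_chain h0 hμ (i + 1)
  exact ((μ (i + 1)).compliant i (by omega)).congr hplay

end PartialPlay

theorem winningRegion_subset_forcingGame : A.winningRegion α ⊆ (A.forcingGame α).winningRegion := by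
  rintro v ⟨σ, hlegal, hwins⟩
  refine ⟨⟨A.PartialPlay σ v, PartialPlay.last, PartialPlay.ExtendsTo,
    ⟨fun _ => v, 0, rfl, fun _ hi => (Nat.not_lt_zero _ hi).elim⟩, rfl, fun p => ⟨?_, ?_⟩, ?_⟩⟩
  · intro hx
    have hmove := hlegal p.play p.length p.play_zero p.compliant hx
    exact ⟨_, p.exists_extendsTo hmove fun _ => rfl, hmove⟩
  · exact fun hx w hw => p.exists_extendsTo hw fun h => (hx h).elim
  · intro μ h0 hμ
    refine hwins _ ?_ (PartialPlay.compliantStep_last_of_chain (by rw [h0]) hμ)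
    exact congrArg PartialPlay.last h0

/-- The memory state reached after a history, where the initial node corresponds to `start` and each
further node updates the state by `advance`. -/
def memoryAfter {M : Type*} (advance : M → N → M) (start : M) (l : List N) : M :=
  l.tail.foldl advance start

theorem memoryAfter_history_zero {M : Type*} (advance : M → N → M) (start : M) (π : ℕ → N) :
    memoryAfter advance start (history π 0) = start := by
  simp [memoryAfter, history]

theorem memoryAfter_history_succ {M : Type*} (advance : M → N → M) (start : M) (π : ℕ → N) (n : ℕ) :
    memoryAfter advance start (history π (n + 1)) =
      advance (memoryAfter advance start (history π n)) (π (n + 1)) := by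
  have hne : history π n ≠ [] := by simp [history]
  simp only [memoryAfter, history_succ, List.tail_append_of_ne_nil hne, List.foldl_append,
    List.foldl_cons, List.foldl_nil]

theorem forcingGame_winningRegion_subset :
    (A.forcingGame α).winningRegion ⊆ A.winningRegion α := by
  rintro v ⟨τ⟩
  have : Nonempty N := ⟨v⟩
  have : Nonempty τ.Memory := ⟨τ.start⟩
  have hreply : ∀ m, τ.pos m ∈ A.exist → ∃ w ∈ τ.pos '' {m' | τ.next m m'}, A.move (τ.pos m) w :=
    fun m => (τ.forces m).1
  have hadvance : ∀ m, ∀ w ∈ τ.pos '' {m' | τ.next m m'}, ∃ m', τ.next m m' ∧ τ.pos m' = w :=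
    fun _ _ hw => hw
  choose! reply hreply_mem hreply_move using hreply
  choose! advance hadvance_next hadvance_pos using hadvance
  let memory (π : ℕ → N) (n : ℕ) : τ.Memory := memoryAfter advance τ.start (history π n)
  let σ : List N → N := fun l => reply (memoryAfter advance τ.start l)
  have hmem : ∀ π n, τ.pos (memory π n) = π n → A.CompliantStep σ π n →
      π (n + 1) ∈ τ.pos '' {m' | τ.next (memory π n) m'} := fun π n hp hs => by
    by_cases hx : π n ∈ A.exist
    · rw [hs.2 hx]
      exact hreply_mem _ (by rwa [hp])
    · exact (τ.forces _).2 (by rwa [hp]) _ (by rw [hp]; exact hs.1)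
  have hpos : ∀ π, π 0 = v → ∀ n, (∀ i < n, A.CompliantStep σ π i) →
      τ.pos (memory π n) = π n := fun π hπ n hs => by
    induction n with
    | zero => exact (congrArg τ.pos (memoryAfter_history_zero ..)).trans (τ.pos_start.trans hπ.symm)
    | succ n ih =>
      simp only [memory, memoryAfter_history_succ]
      exact hadvance_pos _ _ (hmem π n (ih fun i hi => hs i (by omega)) (hs n n.lt_succ_self))
  refine ⟨σ, fun π n hπ hs hx => ?_, fun π hπ hs => ?_⟩
  · have hp := hpos π hπ n hs
    rw [← hp] at hx ⊢
    exact hreply_move _ hx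
  · have hp := fun n => hpos π hπ n fun i _ => hs i
    rw [← show τ.pos ∘ memory π = π from funext hp]
    refine τ.wins _ (memoryAfter_history_zero ..) fun n => ?_
    simp only [memory, memoryAfter_history_succ]
    exact hadvance_next _ _ (hmem π n (hp n) (hs n))

theorem forcingGame_winningRegion : (A.forcingGame α).winningRegion = A.winningRegion α :=
  Set.Subset.antisymm forcingGame_winningRegion_subset winningRegion_subset_forcingGame

end Arena

section Alternation

variable {X Y : Type*}

/-- The sequence `a 0, b 0, a 1, b 1, …`. -/
def interleave (a b : ℕ → X) (n : ℕ) : X := if Even n then a (n / 2) else b (n / 2)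

theorem interleave_two_mul (a b : ℕ → X) (n : ℕ) : interleave a b (2 * n) = a n := by
  simp [interleave]

theorem interleave_two_mul_add_one (a b : ℕ → X) (n : ℕ) :
    interleave a b (2 * n + 1) = b n := by
  simp [interleave, Nat.mul_add_div]

theorem interleave_chain {R : X → X → Prop} {a b : ℕ → X} (hab : ∀ n, R (a n) (b n))
    (hba : ∀ n, R (b n) (a (n + 1))) (n : ℕ) : R (interleave a b n) (interleave a b (n + 1)) := by
  obtain ⟨m, rfl | rfl⟩ := n.even_or_odd'
  · rw [interleave_two_mul, interleave_two_mul_add_one]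
    exact hab m
  · rw [interleave_two_mul_add_one, show 2 * m + 1 + 1 = 2 * (m + 1) by omega, interleave_two_mul]
    exact hba m

theorem exists_eq_inl_inr_of_alternating {f : ℕ → X ⊕ Y} (h0 : (f 0).isLeft)
    (hf : ∀ n, (f (n + 1)).isLeft = !(f n).isLeft) :
    ∃ (a : ℕ → X) (b : ℕ → Y),
      (∀ n, f (2 * n) = .inl (a n)) ∧ ∀ n, f (2 * n + 1) = .inr (b n) := by
  have hleft : ∀ n, (f (2 * n)).isLeft := fun n => by
    induction n with
    | zero => exact h0
    | succ n ih => rw [show 2 * (n + 1) = 2 * n + 1 + 1 by omega, hf, hf, ih, Bool.not_not]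
  have hright : ∀ n, (f (2 * n + 1)).isRight := fun n => by
    rw [← Sum.not_isLeft, hf, hleft, Bool.not_true]
    exact Bool.false_ne_true
  choose a ha using fun n => Sum.isLeft_iff.1 (hleft n)
  choose b hb using fun n => Sum.isRight_iff.1 (hright n)
  exact ⟨a, b, ha, hb⟩

end Alternation

namespace ForcingGame

variable {P Q : Type u} {G : ForcingGame (P ⊕ Q)} {H : ForcingGame P} {p : P}

/-- Each move of `G` leads from `P` to `Q` or from `Q` to `P`, and the rounds of `H` consist of two
moves of `G`, from `P` to `Q` and back. -/
structure IsAlternation (G : ForcingGame (P ⊕ Q)) (H : ForcingGame P) : Prop where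
  force_inl : ∀ S p, .inl p ∈ G.force S → .inl p ∈ G.force (S ∩ Set.range .inr)
  force_inr : ∀ S q, .inr q ∈ G.force S → .inr q ∈ G.force (S ∩ Set.range .inl)
  force_iff : ∀ S p,
    .inl p ∈ G.force (.inr '' {q | .inr q ∈ G.force (.inl '' S)}) ↔ p ∈ H.force S
  objective_iff : ∀ (π : ℕ → P ⊕ Q) (a : ℕ → P) (b : ℕ → Q), (∀ n, π (2 * n) = .inl (a n)) →
    (∀ n, π (2 * n + 1) = .inr (b n)) → (π ∈ G.objective ↔ a ∈ H.objective)

namespace IsAlternation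

/-- Two successive updates of a strategy in the game on `P ⊕ Q`, as one update. -/
def roundStrategy (h : G.IsAlternation H) (τ : G.Strategy (.inl p)) : H.Strategy p where
  Memory := {x : τ.Memory × P // τ.pos x.1 = .inl x.2}
  pos x := x.1.2
  next x y := ∃ m q, τ.pos m = .inr q ∧ τ.next x.1.1 m ∧ τ.next m y.1.1
  start := ⟨(τ.start, p), τ.pos_start⟩
  pos_start := rfl
  forces := by
    rintro ⟨⟨m, p⟩, hm⟩
    have hforce := τ.forces m
    rw [hm] at hforce
    refine (h.force_iff _ _).1 (G.force.monotone ?_ (h.force_inl _ _ hforce))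
    rintro _ ⟨⟨m', hmm', hm'⟩, q, rfl⟩
    have hforce' := τ.forces m'
    rw [hm'] at hforce'
    refine ⟨q, G.force.monotone ?_ (h.force_inr _ _ hforce'), rfl⟩
    rintro _ ⟨⟨m'', hm'm'', hm''⟩, p', rfl⟩
    exact ⟨p', ⟨⟨(m'', p'), hm''⟩, ⟨m', q, hm', hmm', hm'm''⟩, rfl⟩, rfl⟩
  wins := by
    intro μ h0 hμ
    choose ν q hq hμν hνμ using hμ
    refine (h.objective_iff _ _ q (fun n => ?_) fun n => ?_).1
      (τ.wins (interleave (fun n => (μ n).1.1) ν) ?_ (interleave_chain hμν hνμ))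
    · rw [Function.comp_apply, interleave_two_mul]
      exact (μ n).2
    · rw [Function.comp_apply, interleave_two_mul_add_one]
      exact hq n
    · exact (interleave_two_mul _ _ 0).trans (by rw [h0])

/-- A memory state for the positions in `Q` consists of the state before the current round and of
a position from which the existential player can force a position that suits this state. -/
def moveStrategy (h : G.IsAlternation H) (τ : H.Strategy p) : G.Strategy (.inl p) where
  Memory := τ.Memory ⊕
    {x : τ.Memory × Q // .inr x.2 ∈ G.force (.inl '' (τ.pos '' {m' | τ.next x.1 m'}))}
  pos := Sum.map τ.pos fun x => x.1.2
  next
    | .inl m, .inr x => x.1.1 = m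
    | .inr x, .inl m => τ.next x.1.1 m
    | _, _ => False
  start := .inl τ.start
  pos_start := congrArg _ τ.pos_start
  forces := by
    rintro (m | ⟨⟨m, q⟩, hq⟩)
    · refine G.force.monotone ?_ ((h.force_iff _ _).2 (τ.forces m))
      rintro _ ⟨q, hq, rfl⟩
      exact ⟨.inr ⟨(m, q), hq⟩, rfl, rfl⟩
    · refine G.force.monotone ?_ hq
      rintro _ ⟨_, ⟨m', hm', rfl⟩, rfl⟩
      exact ⟨.inl m', hm', rfl⟩
  wins := by
    intro μ h0 hμ
    obtain ⟨a, b, ha, hb⟩ := exists_eq_inl_inr_of_alternating (f := μ) (by rw [h0]; rfl) fun n => by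
      have := hμ n
      rcases h₁ : μ n with m | x <;> rcases h₂ : μ (n + 1) with m' | x' <;> simp_all
    refine (h.objective_iff _ (τ.pos ∘ a) (fun n => (b n).1.2) (fun n => ?_) fun n => ?_).2
      (τ.wins a ?_ fun n => ?_)
    · rw [Function.comp_apply, ha]
      rfl
    · rw [Function.comp_apply, hb]
      rfl
    · exact Sum.inl_injective ((ha 0).symm.trans h0)
    · have hab : (b n).1.1 = a n := by simpa only [ha, hb] using hμ (2 * n)
      have hba : τ.next (b n).1.1 (a (n + 1)) := by
        simpa only [hb, show 2 * n + 1 + 1 = 2 * (n + 1) by omega, ha] using hμ (2 * n + 1)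
      rwa [hab] at hba

theorem inl_mem_winningRegion_iff (h : G.IsAlternation H) :
    .inl p ∈ G.winningRegion ↔ p ∈ H.winningRegion :=
  ⟨fun ⟨τ⟩ => ⟨h.roundStrategy τ⟩, fun ⟨τ⟩ => ⟨h.moveStrategy τ⟩⟩

end IsAlternation

end ForcingGame

namespace SymbolicGame

variable {Var : Type u} {G : SymbolicGame Var}

/-- The game whose rounds are an input followed by an output. -/
def roundGame (G : SymbolicGame Var) : ForcingGame (Var → Bool) where
  force := G.cpre
  objective := {w | G.win.Sat w 0}

theorem isAlternation_roundGame :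
    (G.arena.forcingGame G.objective).IsAlternation G.roundGame where
  force_inl S s hs := ⟨fun ⟨_, h⟩ => (Sum.inr_ne_inl h).elim, fun hx w hw => by
    refine ⟨hs.2 hx w hw, ?_⟩
    rcases w with s' | p
    · exact hw.elim
    · exact ⟨p, rfl⟩⟩
  force_inr S p hp := ⟨fun hx => by
    obtain ⟨s | p', hS, hmove⟩ := hp.1 hx
    · exact ⟨_, ⟨hS, s, rfl⟩, hmove⟩
    · exact hmove.elim, fun hx => (hx ⟨p, rfl⟩).elim⟩
  force_iff S s := by
    constructor
    · rintro ⟨-, h⟩ x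
      obtain ⟨_, ⟨hforce, -⟩, ⟨⟩⟩ := h (fun ⟨_, h⟩ => Sum.inr_ne_inl h) (.inr (s, x)) rfl
      obtain ⟨_, ⟨_, hS, rfl⟩, y, rfl, htrans⟩ := hforce ⟨_, rfl⟩
      exact ⟨y, hS, htrans⟩
    · refine fun h => ⟨fun ⟨_, h⟩ => (Sum.inr_ne_inl h).elim, fun _ w hw => ?_⟩
      rcases w with s' | ⟨s', x⟩
      · exact hw.elim
      · obtain rfl : s' = s := hw
        obtain ⟨y, hS, htrans⟩ := h x
        exact ⟨_, ⟨fun _ => ⟨_, ⟨_, hS, rfl⟩, y, rfl, htrans⟩, fun hx => (hx ⟨_, rfl⟩).elim⟩, rfl⟩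
  objective_iff π w _ hw _ := by
    refine ⟨fun ⟨w', hw', hsat⟩ => ?_, fun hsat => ⟨w, hw, hsat⟩⟩
    obtain rfl : w' = w := funext fun n => Sum.inl_injective ((hw' n).symm.trans (hw n))
    exact hsat

theorem winningRegion_eq_roundGame : G.winningRegion = G.roundGame.winningRegion := by
  ext s
  rw [← isAlternation_roundGame.inl_mem_winningRegion_iff, Arena.forcingGame_winningRegion]
  rfl

end SymbolicGame

namespace FixSystem

variable {N : Type u} {k : ℕ} {S : FixSystem N k}

/-- The game whose rounds are the choice of a tuple `A` followed by that of an element of some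
`A j`. -/
def roundGame (S : FixSystem N k) : ForcingGame (N × Fin k) where
  force :=
    { toFun := fun A => {p | p.1 ∈ S.rhs p.2 fun j => {w | (w, j) ∈ A}}
      monotone' := fun _ _ h p hp => S.mono p.2 (fun _ _ hw => h hw) hp }
  objective := {a | ∃ i, IsLeast {i | ∃ᶠ n in atTop, (a n).2 = i} i ∧ S.kind i = .gfp}

theorem infOften_iff {π : ℕ → (N × Fin k) ⊕ (Fin k → Set N)} {a : ℕ → N × Fin k}
    {b : ℕ → Fin k → Set N} (ha : ∀ n, π (2 * n) = .inl (a n))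
    (hb : ∀ n, π (2 * n + 1) = .inr (b n)) (i : Fin k) :
    InfOften π i ↔ ∃ᶠ n in atTop, (a n).2 = i := by
  rw [frequently_atTop]
  constructor
  · intro h n
    obtain ⟨m, hm, v, hv⟩ := h (2 * n)
    obtain ⟨l, rfl | rfl⟩ := m.even_or_odd'
    · exact ⟨l, by omega, by rw [Sum.inl_injective ((ha l).symm.trans hv)]⟩
    · exact (Sum.inr_ne_inl ((hb l).symm.trans hv)).elim
  · intro h n
    obtain ⟨m, hm, rfl⟩ := h n
    exact ⟨2 * m, by omega, (a m).1, ha m⟩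

theorem isAlternation_roundGame : (S.arena.forcingGame S.objective).IsAlternation S.roundGame where
  force_inl A p hp := ⟨fun hx => by
    obtain ⟨p' | B, hA, hmove⟩ := hp.1 hx
    · exact hmove.elim
    · exact ⟨_, ⟨hA, B, rfl⟩, hmove⟩, fun hx => (hx ⟨p, rfl⟩).elim⟩
  force_inr A B hB := ⟨fun ⟨_, h⟩ => (Sum.inl_ne_inr h).elim, fun hx w hw => by
    refine ⟨hB.2 hx w hw, ?_⟩
    rcases w with p | B'
    · exact ⟨p, rfl⟩
    · exact hw.elim⟩
  force_iff A p := by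
    constructor
    · rintro ⟨h, -⟩
      obtain ⟨_, ⟨B, hB, rfl⟩, hmove⟩ := h ⟨p, rfl⟩
      refine S.mono p.2 (fun j w hw => ?_) hmove
      obtain ⟨_, hA, ⟨⟩⟩ := hB.2 (fun ⟨_, h⟩ => Sum.inl_ne_inr h) (.inl (w, j)) hw
      exact hA
    · refine fun h => ⟨fun _ => ⟨_, ⟨_, ⟨?_, ?_⟩, rfl⟩, h⟩, fun hx => (hx ⟨p, rfl⟩).elim⟩
      · exact fun ⟨_, h⟩ => (Sum.inl_ne_inr h).elim
      · rintro - (p' | B) hw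
        · exact ⟨p', hw, rfl⟩
        · exact hw.elim
  objective_iff π a b ha hb := exists_congr fun i => by
    rw [← and_assoc]
    exact and_congr_left' (and_congr (infOften_iff ha hb i)
      (forall_congr' fun j => imp_congr_left (infOften_iff ha hb j)))

theorem mem_solution_iff {v : N} {i : Fin k} :
    v ∈ S.solution i ↔ (v, i) ∈ S.roundGame.winningRegion := by
  rw [← isAlternation_roundGame.inl_mem_winningRegion_iff, Arena.forcingGame_winningRegion]
  rfl

end FixSystem

/-! ### Zielonka trees and Emerson-Lei games -/

theorem BForm.toLTL_sat {AP : Type*} (w : ℕ → AP → Bool) (ψ : BForm AP) (i : ℕ) :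
    ψ.toLTL.Sat w i ↔ SymbolicGame.NodeSat (w i) ψ := by
  unfold SymbolicGame.NodeSat
  induction ψ with
  | tt => rfl
  | ff => rfl
  | atom p => rfl
  | neg ψ ih => exact not_congr ih
  | conj ψ₁ ψ₂ ih₁ ih₂ => exact and_congr ih₁ ih₂
  | disj ψ₁ ψ₂ ih₁ ih₂ => exact or_congr ih₁ ih₂

theorem BForm.toLTL_injective {AP : Type*} : Function.Injective (BForm.toLTL (AP := AP)) := by
  intro φ ψ h
  induction φ generalizing ψ <;> cases ψ <;> grind [BForm.toLTL]

theorem LTL.self_mem_subformulas {AP : Type*} (φ : LTL AP) : φ ∈ φ.subformulas := by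
  cases φ <;> simp [LTL.subformulas]

theorem LTL.subformulas_finite {AP : Type*} (φ : LTL AP) : φ.subformulas.Finite := by
  induction φ <;> simp_all [LTL.subformulas]

theorem boolSubformulas_finite {AP : Type*} (φ : ELFormula (BForm AP)) :
    (boolSubformulas φ).Finite :=
  (elToLTL φ).subformulas_finite.preimage BForm.toLTL_injective.injOn

theorem elToLTL_sat_iff {AP : Type*} (w : ℕ → AP → Bool) {C : Set (BForm AP)}
    {φ : ELFormula (BForm AP)} (hC : boolSubformulas φ ⊆ C) (i : ℕ) :
    (elToLTL φ).Sat w i ↔ φ.Sat {c | ∃ᶠ n in atTop, c ∈ coloring C (w n)} := by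
  induction φ with
  | tt => rfl
  | ff => rfl
  | atom ψ =>
    have hψ : ψ ∈ C := hC (Or.inr (Or.inr (LTL.self_mem_subformulas _)))
    simp only [elToLTL, LTL.Sat, BForm.toLTL_sat, BForm.Sat, coloring, Set.mem_ofPred_eq, hψ,
      true_and, frequently_atTop]
    refine ⟨fun h a => ?_, fun h j _ => h j⟩
    obtain ⟨j, hj, hs⟩ := h (max a i) (le_max_right _ _)
    exact ⟨j, (le_max_left _ _).trans hj, hs⟩
  | neg ψ ih => exact not_congr (ih fun c hc => hC (Or.inr hc))
  | conj ψ₁ ψ₂ ih₁ ih₂ =>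
    exact and_congr (ih₁ fun c hc => hC (Or.inr (Or.inl hc)))
      (ih₂ fun c hc => hC (Or.inr (Or.inr hc)))
  | disj ψ₁ ψ₂ ih₁ ih₂ =>
    exact or_congr (ih₁ fun c hc => hC (Or.inr (Or.inl hc)))
      (ih₂ fun c hc => hC (Or.inr (Or.inr hc)))

/-- The game with the predecessor function `cpre` in which the existential player wants the set of
colors seen infinitely often to satisfy `φ`. -/
def elGame {N : Type u} {Col : Type*} (φ : ELFormula Col) (γ : N → Set Col)
    (cpre : Set N →o Set N) : ForcingGame N where
  force := cpre
  objective := {w | φ.Sat {c | ∃ᶠ n in atTop, c ∈ γ (w n)}}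

theorem SymbolicGame.roundGame_eq_elGame {Var : Type u} {G : SymbolicGame Var}
    {φ : ELFormula (BForm Var)} {C : Set (BForm Var)} (hC : boolSubformulas φ ⊆ C)
    (hwin : ∀ w : ℕ → Var → Bool, G.win.Sat w 0 ↔ (elToLTL φ).Sat w 0) :
    G.roundGame = elGame φ (coloring C) G.cpre := by
  simp only [SymbolicGame.roundGame, elGame, hwin, elToLTL_sat_iff _ hC]

namespace ZVertex

variable {N Col : Type*} {φ : ELFormula Col} {C : Set Col} {γ : N → Set Col}

/-- The leaves of the tree. -/
def IsLeaf (s : ZVertex φ C) : Prop := s.children = ∅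

/-- The number of vertices on the way from the root to a vertex, both included. -/
def depth (t : ZVertex φ C) : ℕ := t.1.length

theorem depth_pos (t : ZVertex φ C) : 0 < t.depth := by
  obtain ⟨p, hp⟩ := t
  cases hp <;> exact Nat.succ_pos _

theorem Anc.refl (s : ZVertex φ C) : s.Anc s := List.suffix_refl _

theorem Anc.trans {s t u : ZVertex φ C} (h : s.Anc t) (h' : t.Anc u) : s.Anc u :=
  List.IsSuffix.trans h h'

theorem Anc.depth_le {s t : ZVertex φ C} (h : s.Anc t) : s.depth ≤ t.depth :=
  List.IsSuffix.length_le h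

theorem Anc.eq_of_depth_le {s t : ZVertex φ C} (h : s.Anc t) (h' : t.depth ≤ s.depth) : s = t :=
  Subtype.ext (List.IsSuffix.eq_of_length_le h h')

theorem Anc.total {s t u : ZVertex φ C} (hs : s.Anc u) (ht : t.Anc u) : s.Anc t ∨ t.Anc s :=
  List.suffix_or_suffix_of_suffix hs ht

theorem depth_of_mem_children {s t : ZVertex φ C} (h : t ∈ s.children) :
    t.depth = s.depth + 1 := by
  obtain ⟨D, hD⟩ := h
  simp [depth, hD]

theorem anc_of_mem_children {s t : ZVertex φ C} (h : t ∈ s.children) : s.Anc t := by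
  obtain ⟨D, hD⟩ := h
  unfold Anc
  rw [hD]
  exact List.suffix_cons D s.1

theorem eq_or_eq_of_anc_of_anc_child {s s' t : ZVertex φ C} (ht : t ∈ s.children) (h : s.Anc s')
    (h' : s'.Anc t) : s' = s ∨ s' = t := by
  refine or_iff_not_imp_left.2 fun hne => h'.eq_of_depth_le ?_
  rw [depth_of_mem_children ht]
  by_contra hlt
  exact hne (h.eq_of_depth_le (by omega)).symm

theorem root_anc (t : ZVertex φ C) : (root φ C).Anc t := by
  obtain ⟨p, hp⟩ := t
  induction hp with
  | root => exact Anc.refl _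
  | child hp _ ih => exact List.IsSuffix.trans ih (List.suffix_cons _ _)

theorem label_antitone {s t : ZVertex φ C} (h : s.Anc t) : t.label ⊆ s.label := by
  obtain ⟨p, hp⟩ := t
  induction hp with
  | root => rw [show s = root φ C from h.eq_of_depth_le s.depth_pos]; exact subset_rfl
  | @child p D hp hD ih =>
    rcases List.suffix_cons_iff.1 h with h' | h'
    · obtain rfl : s = ⟨D :: p, .child hp hD⟩ := Subtype.ext h'
      exact subset_rfl
    · exact hD.prop.1.1.trans (ih h')

theorem exists_child_superset (hC : C.Finite) (s : ZVertex φ C) {D : Set Col} (hD : D ⊆ s.label)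
    (h : ¬ (φ.Sat D ↔ s.Winning)) : ∃ t ∈ s.children, D ⊆ t.label := by
  have hfin : {D' | D' ⊂ s.label ∧ (φ.Sat D' ↔ ¬ φ.Sat s.label)}.Finite :=
    (hC.subset (label_antitone s.root_anc)).finite_subsets.subset fun D' h => h.1.1
  have hDmem : D ∈ {D' | D' ⊂ s.label ∧ (φ.Sat D' ↔ ¬ φ.Sat s.label)} :=
    ⟨hD.ssubset_of_ne fun hD => h (hD ▸ Iff.rfl), (not_iff_comm.1 (not_iff.1 h)).symm⟩
  obtain ⟨D', hle, hmax⟩ := hfin.exists_le_maximal hDmem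
  exact ⟨⟨D' :: s.1, .child s.2 hmax⟩, ⟨D', rfl⟩, hle⟩

theorem exists_depth_le [Finite (ZVertex φ C)] : ∃ B, ∀ t : ZVertex φ C, t.depth ≤ B := by
  obtain ⟨B, hB⟩ := (Set.finite_range (depth (φ := φ) (C := C))).bddAbove
  exact ⟨B, fun t => hB ⟨t, rfl⟩⟩

theorem mem_anchor_self {t : ZVertex φ C} {v : N} : v ∈ anchor γ t t ↔ γ v ⊆ t.label := by
  refine and_iff_left fun u hu hut => ?_
  have := depth_of_mem_children hu
  have := hut.depth_le
  omega

theorem exists_anchor {v : N} (hv : γ v ⊆ C) (t : ZVertex φ C) :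
    ∃ s, s.Anc t ∧ v ∈ anchor γ s t := by
  obtain ⟨p, hp⟩ := t
  induction hp with
  | root => exact ⟨root φ C, Anc.refl _, mem_anchor_self.2 hv⟩
  | @child p D hp hD ih =>
    by_cases hvD : γ v ⊆ D
    · exact ⟨⟨D :: p, .child hp hD⟩, Anc.refl _, mem_anchor_self.2 hvD⟩
    · obtain ⟨s, hs, hvs, hout⟩ := ih
      refine ⟨s, hs.trans (List.suffix_cons D p), hvs, fun u hu hut => ?_⟩
      rcases List.suffix_cons_iff.1 hut with hut | hut
      · rwa [show u = ⟨D :: p, .child hp hD⟩ from Subtype.ext hut]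
      · exact hout u hu hut

theorem mem_rhs_of_isLeaf {s : ZVertex φ C} (hs : s.IsLeaf) {cpre : Set N →o Set N}
    {X : ZVertex φ C → Set N} {v : N} :
    v ∈ rhs γ cpre s X ↔ ∃ s', s'.Anc s ∧ v ∈ anchor γ s' s ∧ v ∈ cpre (X s') := by
  simp only [rhs, show s.children = ∅ from hs, if_true, Set.mem_iUnion, Set.mem_inter_iff,
    exists_prop, Set.mem_ofPred_eq]

theorem mem_rhs_of_winning {s : ZVertex φ C} (hs : ¬ s.IsLeaf) (hw : s.Winning)
    {cpre : Set N →o Set N} {X : ZVertex φ C → Set N} {v : N} :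
    v ∈ rhs γ cpre s X ↔ ∀ t ∈ s.children, v ∈ X t := by
  rw [rhs, if_neg (show s.children ≠ ∅ from hs), if_pos hw, Set.mem_iInter₂]

theorem mem_rhs_of_losing {s : ZVertex φ C} (hs : ¬ s.IsLeaf) (hw : ¬ s.Winning)
    {cpre : Set N →o Set N} {X : ZVertex φ C → Set N} {v : N} :
    v ∈ rhs γ cpre s X ↔ ∃ t ∈ s.children, v ∈ X t := by
  rw [rhs, if_neg (show s.children ≠ ∅ from hs), if_neg hw]
  simp only [Set.mem_iUnion, exists_prop]

theorem kind_eq_gfp_iff {s : ZVertex φ C} : s.kind = .gfp ↔ s.Winning := by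
  unfold kind
  split_ifs with h <;> simp [h]

end ZVertex

namespace ZVertex

variable {N Col : Type*} {φ : ELFormula Col} {C : Set Col} {γ : N → Set Col}

/-- A round of the fixpoint game of an Emerson-Lei equation system: it descends from an inner vertex
to one of its children and returns from a leaf to the anchor of the current node `v`. -/
structure IsRunStep (γ : N → Set Col) (v : N) (s : ZVertex φ C) (v' : N) (s' : ZVertex φ C) :
    Prop where
  inner : ¬ s.IsLeaf → v' = v ∧ s' ∈ s.children
  leaf : s.IsLeaf → s'.Anc s ∧ v ∈ anchor γ s' s

/-- A sequence of rounds of the fixpoint game. -/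
def IsRun (γ : N → Set Col) (v : ℕ → N) (s : ℕ → ZVertex φ C) : Prop :=
  ∀ i, IsRunStep γ (v i) (s i) (v (i + 1)) (s (i + 1))

/-- The vertex `r` is visited infinitely often, and none of its proper ancestors is. -/
def IsDominant (s : ℕ → ZVertex φ C) (r : ZVertex φ C) : Prop :=
  (∃ᶠ i in atTop, s i = r) ∧ ∀ t, (∃ᶠ i in atTop, s i = t) → t.Anc r → t = r

theorem isDominant_of_isLeast {k : ℕ} {e : ZVertex φ C ≃ Fin k}
    (he : ∀ s t, s.Anc t → e s ≤ e t) {s : ℕ → ZVertex φ C} {r : ZVertex φ C}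
    (hr : IsLeast {j | ∃ᶠ i in atTop, e (s i) = j} (e r)) : IsDominant s r := by
  have freq_iff : ∀ t, e t ∈ {j | ∃ᶠ i in atTop, e (s i) = j} ↔ ∃ᶠ i in atTop, s i = t :=
    fun t => by simp only [Set.mem_ofPred_eq, e.apply_eq_iff_eq]
  exact ⟨(freq_iff r).1 hr.1, fun t ht htr =>
    e.injective ((he t r htr).antisymm (hr.2 ((freq_iff t).2 ht)))⟩

theorem IsRunStep.anc_or_anc {v v' : N} {s s' t : ZVertex φ C} (h : IsRunStep γ v s v' s')
    (ht : t.Anc s) : t.Anc s' ∨ s.IsLeaf ∧ s'.Anc t := by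
  by_cases hs : s.IsLeaf
  · exact (ht.total (h.leaf hs).1).imp_right fun h => ⟨hs, h⟩
  · exact .inl (ht.trans (anc_of_mem_children (h.inner hs).2))

namespace IsRun

variable {v : ℕ → N} {s : ℕ → ZVertex φ C} {r t : ZVertex φ C}

theorem frequently_isLeaf [Finite (ZVertex φ C)] (h : IsRun γ v s) :
    ∃ᶠ i in atTop, (s i).IsLeaf := by
  obtain ⟨B, hB⟩ := exists_depth_le (φ := φ) (C := C)
  refine frequently_of_rank_lt (ρ := fun i => B - (s i).depth) fun i hi => ?_
  have := depth_of_mem_children ((h i).inner hi).2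
  have := hB (s (i + 1))
  omega

theorem eventually_anc [Finite (ZVertex φ C)] (h : IsRun γ v s) (hr : IsDominant s r) :
    ∀ᶠ i in atTop, r.Anc (s i) := by
  obtain ⟨n, hn⟩ := eventually_atTop.1 (eventually_frequently_eq s)
  obtain ⟨m, hm, hsm⟩ := frequently_atTop.1 hr.1 n
  refine eventually_atTop.2 ⟨m, fun i hi => ?_⟩
  induction i, hi using Nat.le_induction with
  | base => exact hsm ▸ Anc.refl _
  | succ i hi ih =>
    rcases (h i).anc_or_anc ih with hanc | ⟨-, hanc⟩
    · exact hanc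
    · exact hr.2 _ (hn (i + 1) (by omega)) hanc ▸ Anc.refl _

theorem eventually_color_subset [Finite (ZVertex φ C)] (h : IsRun γ v s) (hr : IsDominant s r) :
    ∀ᶠ i in atTop, γ (v i) ⊆ r.label := by
  classical
  obtain ⟨n, hn⟩ := eventually_atTop.1 (h.eventually_anc hr)
  refine eventually_atTop.2 ⟨n, fun i hi => ?_⟩
  have hleaf := h.frequently_isLeaf
  rw [← apply_nth_count hleaf (fun i hi => ((h i).inner hi).1) i]
  have hle := Nat.le_nth_count (Nat.frequently_atTop_iff_infinite.1 hleaf) i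
  exact ((h _).leaf (nth_mem_of_frequently hleaf _)).2.1.trans
    (label_antitone (hn _ (by omega)))

theorem exists_color_not_subset (h : IsRun γ v s) (ht : t ∈ r.children) {i j : ℕ}
    (hr : ∀ l, i ≤ l → r.Anc (s l)) (hi : s i = t) (hij : i ≤ j) (hj : s j = r) :
    ∃ l, i ≤ l ∧ ¬ γ (v l) ⊆ t.label := by
  by_contra! hsub
  have hstay : ∀ l, i ≤ l → t.Anc (s l) := fun l hl => by
    induction l, hl using Nat.le_induction with
    | base => exact hi ▸ Anc.refl _
    | succ l hl ih =>
      rcases (h l).anc_or_anc ih with hanc | ⟨hleaf, hanc⟩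
      · exact hanc
      · rcases eq_or_eq_of_anc_of_anc_child ht (hr _ (by omega)) hanc with hs | hs
        · have hanchor := ((h l).leaf hleaf).2
          rw [hs] at hanchor
          exact (hanchor.2 t ht ih (hsub l hl)).elim
        · exact hs ▸ Anc.refl _
  have := (hstay j hij).depth_le
  rw [hj, depth_of_mem_children ht] at this
  omega

theorem frequently_color_not_subset [Finite (ZVertex φ C)] (h : IsRun γ v s)
    (hr : IsDominant s r) (ht : t ∈ r.children) (hst : ∃ᶠ i in atTop, s i = t) :
    ∃ᶠ i in atTop, ¬ γ (v i) ⊆ t.label := by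
  obtain ⟨n, hn⟩ := eventually_atTop.1 (h.eventually_anc hr)
  refine frequently_atTop.2 fun m => ?_
  obtain ⟨i, hi, hit⟩ := frequently_atTop.1 hst (max m n)
  obtain ⟨j, hj, hjr⟩ := frequently_atTop.1 hr.1 i
  obtain ⟨l, hl, hlt⟩ := h.exists_color_not_subset ht (fun l hl => hn l (by omega)) hit hj hjr
  exact ⟨l, by omega, hlt⟩

theorem sat_iff_winning [Finite (ZVertex φ C)] (hC : C.Finite) (h : IsRun γ v s)
    (hr : IsDominant s r) (hrot : ∀ t ∈ r.children, ∃ᶠ i in atTop, s i = t) :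
    φ.Sat {c | ∃ᶠ i in atTop, c ∈ γ (v i)} ↔ r.Winning := by
  have hsub := h.eventually_color_subset hr
  by_contra hne
  obtain ⟨t, ht, hDt⟩ := exists_child_superset hC r (fun c hc =>
    (hsub.and_frequently hc).exists.elim fun _ hi => hi.1 hi.2) hne
  have hout : ∃ᶠ i in atTop, ∃ c ∈ r.label \ t.label, c ∈ γ (v i) :=
    ((h.frequently_color_not_subset hr ht (hrot t ht)).and_eventually hsub).mono fun i hi => by
      obtain ⟨c, hc, hct⟩ := Set.not_subset.1 hi.1
      exact ⟨c, ⟨hi.2 hc, hct⟩, hc⟩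
  have hfin : (r.label \ t.label).Finite := (hC.subset (label_antitone r.root_anc)).sdiff
  obtain ⟨c, hc, hfreq⟩ := (frequently_exists_finite hfin).1 hout
  exact hc.2 (hDt hfreq)

end IsRun

/-- For each inner vertex `s`, the sequence `f s` takes each child of `s` as a value infinitely
often, and no other values. -/
def IsChildRotation (f : ZVertex φ C → ℕ → ZVertex φ C) : Prop :=
  ∀ s, ¬ s.IsLeaf → (∀ n, f s n ∈ s.children) ∧ ∀ t ∈ s.children, ∃ᶠ n in atTop, f s n = t

theorem exists_isChildRotation [Finite (ZVertex φ C)] :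
    ∃ f : ZVertex φ C → ℕ → ZVertex φ C, IsChildRotation f := by
  have hex : ∀ s : ZVertex φ C, ¬ s.IsLeaf → ∃ g : ℕ → ZVertex φ C,
      (∀ n, g n ∈ s.children) ∧ ∀ t ∈ s.children, ∃ᶠ n in atTop, g n = t := fun s hs =>
    exists_seq_frequently_eq s.children.to_countable (Set.nonempty_iff_ne_empty.2 hs)
  have : Nonempty (ZVertex φ C) := ⟨root φ C⟩
  choose! f hf using hex
  exact ⟨f, hf⟩

/-- A position of the fixpoint game, together with the list of the vertices visited before. -/
structure RunState (N : Type*) (φ : ELFormula Col) (C : Set Col) where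
  node : N
  vertex : ZVertex φ C
  visited : List (ZVertex φ C)

open Classical in
/-- A round of the fixpoint game that leaves an inner vertex of `B` for the next child in the
rotation `f`. -/
structure IsRotatingStep (γ : N → Set Col) (f : ZVertex φ C → ℕ → ZVertex φ C)
    (B : Set (ZVertex φ C)) (q q' : RunState N φ C) : Prop
    extends IsRunStep γ q.node q.vertex q'.node q'.vertex where
  rotate : q.vertex ∈ B → ¬ q.vertex.IsLeaf →
    q'.vertex = f q.vertex (q.visited.count q.vertex)
  record : q'.visited = q.vertex :: q.visited

variable {f : ZVertex φ C → ℕ → ZVertex φ C} {B : Set (ZVertex φ C)}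

theorem sat_iff_winning_of_isRotatingStep [Finite (ZVertex φ C)] (hC : C.Finite)
    (hf : IsChildRotation f) {q : ℕ → RunState N φ C} (h0 : (q 0).visited = [])
    (hq : ∀ i, IsRotatingStep γ f B (q i) (q (i + 1))) {r : ZVertex φ C}
    (hr : IsDominant (fun i => (q i).vertex) r) (hrB : r ∈ B) :
    φ.Sat {c | ∃ᶠ i in atTop, c ∈ γ (q i).node} ↔ r.Winning := by
  classical
  refine IsRun.sat_iff_winning hC (fun i => (hq i).toIsRunStep) hr fun t ht => ?_
  have hleaf : ¬ r.IsLeaf := Set.nonempty_iff_ne_empty.1 ⟨t, ht⟩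
  have hcount := count_eq_nat_count (s := fun i => (q i).vertex) (l := fun i => (q i).visited) h0
    (fun i => (hq i).record) r
  refine frequently_of_rotation hr.1 (f := f r) (fun i hi => ?_) ((hf r hleaf).2 t ht)
  rw [(hq i).rotate (hi ▸ hrB) (hi ▸ hleaf), ← hcount, hi]

end ZVertex

/-! ### Strategies with internal updates -/

theorem exists_retraction_of_rank_lt {X : Type*} {S : Set X} {d : X → X} {rank : X → ℕ}
    (hd : ∀ x ∉ S, rank (d x) < rank x) :
    ∃ z : X → X, (∀ x, z x ∈ S) ∧ (∀ x ∈ S, z x = x) ∧ ∀ x ∉ S, z x = z (d x) := by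
  classical
  have hex : ∀ x, ∃ n, d^[n] x ∈ S := fun x =>
    (frequently_of_rank_lt (ρ := fun i => rank (d^[i] x)) fun i hi => by
      simpa only [Function.iterate_succ_apply'] using hd _ hi).exists
  refine ⟨fun x => d^[Nat.find (hex x)] x, fun x => Nat.find_spec (hex x), fun x hx => ?_,
    fun x hx => ?_⟩ <;> beta_reduce
  · rw [(Nat.find_eq_zero (hex x)).2 hx]
    rfl
  · rw [Nat.find_comp_succ (hex x) (hex (d x)) hx]
    rfl

theorem exists_recursive_seq_count {X : Type*} (S : Set X) [DecidablePred (· ∈ S)] (d : X → X)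
    (ν : ℕ → X) (x₀ : X) :
    ∃ x : ℕ → X, x 0 = x₀ ∧ (∀ i, x i ∈ S → x (i + 1) = ν (Nat.count (x · ∈ S) i)) ∧
      ∀ i, x i ∉ S → x (i + 1) = d (x i) := by
  let step (y : X × ℕ) : X × ℕ := if y.1 ∈ S then (ν y.2, y.2 + 1) else (d y.1, y.2)
  let y (i : ℕ) : X × ℕ := step^[i] (x₀, 0)
  have y_mem : ∀ i, (y i).1 ∈ S → y (i + 1) = (ν (y i).2, (y i).2 + 1) := fun i hi =>
    (Function.iterate_succ_apply' step i _).trans (if_pos hi)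
  have y_notMem : ∀ i, (y i).1 ∉ S → y (i + 1) = (d (y i).1, (y i).2) := fun i hi =>
    (Function.iterate_succ_apply' step i _).trans (if_neg hi)
  have hcount : ∀ i, (y i).2 = Nat.count (fun j => (y j).1 ∈ S) i := fun i => by
    induction i with
    | zero => rfl
    | succ i ih =>
      by_cases hi : (y i).1 ∈ S
      · rw [y_mem i hi, Nat.count_succ, if_pos hi, ih]
      · rw [y_notMem i hi, Nat.count_succ, if_neg hi, ih, Nat.add_zero]
  exact ⟨fun i => (y i).1, rfl, fun i hi => by simp only [y_mem i hi, hcount],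
    fun i hi => by simp only [y_notMem i hi]⟩

namespace ForcingGame

variable {P : Type u} {G : ForcingGame P} {p : P}

/-- A winning strategy in which only the transitions that leave a settled memory state are moves. In
the other states the existential player updates the memory on her own, and the rank ensures that
this terminates. -/
structure StutteringStrategy (G : ForcingGame P) (p : P) where
  Memory : Type u
  pos : Memory → P
  next : Memory → Memory → Prop
  start : Memory
  settled : Set Memory
  rank : Memory → ℕ
  pos_start : pos start = p
  settles : ∀ m ∉ settled, ∃ m', next m m' ∧ pos m' = pos m ∧ rank m' < rank m
  forces : ∀ m ∈ settled, pos m ∈ G.force (pos '' {m' | next m m'})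
  wins : ∀ μ : ℕ → Memory, μ 0 = start → (∀ n, next (μ n) (μ (n + 1))) →
    (fun n => pos (μ (Nat.nth (μ · ∈ settled) n))) ∈ G.objective

namespace StutteringStrategy

variable (τ : G.StutteringStrategy p) {d z : τ.Memory → τ.Memory}

theorem exists_expansion (hd : ∀ m ∉ τ.settled, τ.next m (d m) ∧ τ.rank (d m) < τ.rank m)
    (hzS : ∀ m ∈ τ.settled, z m = m) (hzd : ∀ m ∉ τ.settled, z m = z (d m))
    {μ ν : ℕ → τ.Memory} (h0 : μ 0 = z τ.start) (hμν : ∀ n, τ.next (μ n) (ν n))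
    (hνμ : ∀ n, z (ν n) = μ (n + 1)) :
    ∃ x : ℕ → τ.Memory, x 0 = τ.start ∧ (∀ i, τ.next (x i) (x (i + 1))) ∧
      ∀ n, x (Nat.nth (x · ∈ τ.settled) n) = μ n := by
  classical
  -- `x` runs through the play `μ` of settled states, with the updates by `d` inserted.
  obtain ⟨x, hx0, hx_settled, hx_unsettled⟩ := exists_recursive_seq_count τ.settled d ν τ.start
  have hz : ∀ i, z (x i) = μ (Nat.count (x · ∈ τ.settled) i) := fun i => by
    induction i with
    | zero => rw [Nat.count_zero, hx0, h0]
    | succ i ih =>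
      by_cases hi : x i ∈ τ.settled
      · rw [hx_settled i hi, hνμ, Nat.count_succ, if_pos hi]
      · rw [hx_unsettled i hi, ← hzd _ hi, ih, Nat.count_succ, if_neg hi, Nat.add_zero]
  have hxμ : ∀ i, x i ∈ τ.settled → x i = μ (Nat.count (x · ∈ τ.settled) i) := fun i hi => by
    rw [← hz, hzS _ hi]
  have hfreq : ∃ᶠ i in atTop, x i ∈ τ.settled :=
    frequently_of_rank_lt (ρ := fun i => τ.rank (x i)) fun i hi => by
      rw [hx_unsettled i hi]
      exact (hd _ hi).2
  refine ⟨x, hx0, fun i => ?_, fun n => ?_⟩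
  · by_cases hi : x i ∈ τ.settled
    · rw [hx_settled i hi, hxμ i hi]
      exact hμν _
    · rw [hx_unsettled i hi]
      exact (hd _ hi).1
  · rw [hxμ _ (nth_mem_of_frequently hfreq n), count_nth_of_frequently hfreq]

end StutteringStrategy

theorem mem_winningRegion_of_stutteringStrategy (τ : G.StutteringStrategy p) :
    p ∈ G.winningRegion := by
  have : Nonempty τ.Memory := ⟨τ.start⟩
  have settles := τ.settles
  choose! d hnext hpos hrank using settles
  obtain ⟨z, hz, hzS, hzd⟩ := exists_retraction_of_rank_lt hrank
  have hzpos : ∀ m, τ.pos (z m) = τ.pos m := fun m => by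
    induction h : τ.rank m using Nat.strong_induction_on generalizing m with
    | _ n ih =>
      by_cases hm : m ∈ τ.settled
      · rw [hzS m hm]
      · rw [hzd m hm, ih _ (h ▸ hrank m hm) _ rfl, hpos m hm]
  refine ⟨⟨τ.settled, fun m => τ.pos m, fun m m' => ∃ m₁, τ.next m m₁ ∧ z m₁ = m',
    ⟨z τ.start, hz _⟩, (hzpos _).trans τ.pos_start, fun m => ?_, fun μ h0 hμ => ?_⟩⟩
  · refine G.force.monotone ?_ (τ.forces m m.2)
    rintro _ ⟨m₁, hm₁, rfl⟩
    exact ⟨⟨z m₁, hz _⟩, ⟨m₁, hm₁, rfl⟩, hzpos m₁⟩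
  · choose ν hμν hνμ using hμ
    obtain ⟨x, hx0, hx, hxμ⟩ := τ.exists_expansion (fun m hm => ⟨hnext m hm, hrank m hm⟩) hzS hzd
      (congrArg Subtype.val h0) hμν hνμ
    have hwins := τ.wins x hx0 hx
    simp only [hxμ] at hwins
    exact hwins

end ForcingGame

/-! ### The equation system and the Emerson-Lei game -/

namespace ELSystem

open ZVertex

variable {N Col : Type u} {φ : ELFormula Col} {C : Set Col} {γ : N → Set Col}
  {cpre : Set N →o Set N} {k : ℕ} {e : ZVertex φ C ≃ Fin k} {f : ZVertex φ C → ℕ → ZVertex φ C}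

theorem mem_objective_iff {a : ℕ → N × Fin k} :
    a ∈ (elSystem e γ cpre).roundGame.objective ↔
      ∃ r : ZVertex φ C, IsLeast {j | ∃ᶠ n in atTop, (a n).2 = j} (e r) ∧ r.Winning := by
  refine e.symm.exists_congr fun i => and_congr ?_ kind_eq_gfp_iff
  rw [e.apply_symm_apply]

section FixpointStrategy

variable {v : N} (σ : (elGame φ γ cpre).Strategy v)

/-- The position of the fixpoint game at a memory state of the existential player, who remembers a
memory state of `σ`, the current vertex and the vertices visited before. -/
def runState (x : σ.Memory × ZVertex φ C × List (ZVertex φ C)) : RunState N φ C :=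
  ⟨σ.pos x.1, x.2.1, x.2.2⟩

/-- A round of the fixpoint game in which the existential player rotates through the children of the
losing vertices and follows `σ` at the leaves. -/
structure Follows (f : ZVertex φ C → ℕ → ZVertex φ C)
    (x y : σ.Memory × ZVertex φ C × List (ZVertex φ C)) : Prop where
  step : IsRotatingStep γ f {s | ¬ s.Winning} (runState σ x) (runState σ y)
  next : x.2.1.IsLeaf → σ.next x.1 y.1
  stay : ¬ x.2.1.IsLeaf → y.1 = x.1

variable {σ}

theorem Follows.of_mem_children {x : σ.Memory × ZVertex φ C × List (ZVertex φ C)}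
    {t : ZVertex φ C} (ht : t ∈ x.2.1.children)
    (hrot : open Classical in ¬ x.2.1.Winning → t = f x.2.1 (x.2.2.count x.2.1)) :
    Follows σ f x (x.1, t, x.2.1 :: x.2.2) :=
  have hx : ¬ x.2.1.IsLeaf := Set.nonempty_iff_ne_empty.1 ⟨t, ht⟩
  ⟨⟨⟨fun _ => ⟨rfl, ht⟩, fun h => (hx h).elim⟩, fun h _ => hrot h, rfl⟩, fun h => (hx h).elim,
    fun _ => rfl⟩

theorem follows_forces (hγ : ∀ w, γ w ⊆ C) (hf : IsChildRotation f)
    (x : σ.Memory × ZVertex φ C × List (ZVertex φ C)) :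
    σ.pos x.1 ∈ rhs γ cpre x.2.1 fun t =>
      {w | ∃ y, Follows σ f x y ∧ σ.pos y.1 = w ∧ y.2.1 = t} := by
  by_cases hleaf : x.2.1.IsLeaf
  · obtain ⟨s, hs, hanchor⟩ := exists_anchor (hγ (σ.pos x.1)) x.2.1
    refine (mem_rhs_of_isLeaf hleaf).2 ⟨s, hs, hanchor, cpre.monotone ?_ (σ.forces x.1)⟩
    rintro _ ⟨m, hm, rfl⟩
    exact ⟨(m, s, x.2.1 :: x.2.2), ⟨⟨⟨fun h => (h hleaf).elim, fun _ => ⟨hs, hanchor⟩⟩,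
      fun _ h => (h hleaf).elim, rfl⟩, fun _ => hm, fun h => (h hleaf).elim⟩, rfl, rfl⟩
  · by_cases hw : x.2.1.Winning
    · exact (mem_rhs_of_winning hleaf hw).2 fun t ht =>
        ⟨_, .of_mem_children ht fun h => (h hw).elim, rfl, rfl⟩
    · exact (mem_rhs_of_losing hleaf hw).2
        ⟨_, (hf _ hleaf).1 _, _, .of_mem_children ((hf _ hleaf).1 _) fun _ => rfl, rfl, rfl⟩

theorem sat_of_follows [Finite (ZVertex φ C)]
    {μ : ℕ → σ.Memory × ZVertex φ C × List (ZVertex φ C)} (h0 : (μ 0).1 = σ.start)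
    (hμ : ∀ i, Follows σ f (μ i) (μ (i + 1))) :
    φ.Sat {c | ∃ᶠ i in atTop, c ∈ γ (σ.pos (μ i).1)} := by
  have hleaf : ∃ᶠ i in atTop, (μ i).2.1.IsLeaf :=
    IsRun.frequently_isLeaf (γ := γ) (v := fun i => σ.pos (μ i).1) (s := fun i => (μ i).2.1)
      fun i => (hμ i).step.toIsRunStep
  have hstay := fun i => (hμ i).stay
  have hwins := σ.wins (fun n => (μ (Nat.nth (fun i => (μ i).2.1.IsLeaf) n)).1)
    ((apply_nth_zero (a := fun i => (μ i).1) hleaf hstay).trans h0) fun n => by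
      rw [apply_nth_succ (a := fun i => (μ i).1) hleaf hstay n]
      exact (hμ _).next (nth_mem_of_frequently hleaf n)
  have hcolors : {c | ∃ᶠ n in atTop, c ∈ γ (σ.pos (μ (Nat.nth (fun i => (μ i).2.1.IsLeaf) n)).1)} =
      {c | ∃ᶠ i in atTop, c ∈ γ (σ.pos (μ i).1)} := Set.ext fun c =>
    frequently_apply_nth_iff (a := fun i => (μ i).1) hleaf hstay fun m => c ∈ γ (σ.pos m)
  rwa [← hcolors]

theorem elGame_winningRegion_subset (hC : C.Finite) (hγ : ∀ w, γ w ⊆ C)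
    (he : ∀ s t, s.Anc t → e s ≤ e t) (t : ZVertex φ C) :
    (elGame φ γ cpre).winningRegion ⊆ (elSystem e γ cpre).solution (e t) := by
  rintro v ⟨σ⟩
  have : Finite (ZVertex φ C) := .of_equiv _ e.symm
  obtain ⟨f, hf⟩ := exists_isChildRotation (φ := φ) (C := C)
  refine FixSystem.mem_solution_iff.2 ⟨⟨σ.Memory × ZVertex φ C × List (ZVertex φ C),
    fun x => (σ.pos x.1, e x.2.1), Follows σ f, (σ.start, t, []), by rw [σ.pos_start],
    fun x => ?_, fun μ h0 hμ => ?_⟩⟩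
  · have hforces := follows_forces hγ hf x
    rw [← e.symm_apply_apply x.2.1] at hforces
    refine rhs_mono γ cpre _ (fun t w => ?_) hforces
    rintro ⟨y, hy, rfl, rfl⟩
    exact ⟨y, hy, rfl⟩
  · obtain ⟨i, hi⟩ := exists_isLeast_frequently fun n => e (μ n).2.1
    obtain ⟨r, rfl⟩ := e.surjective i
    refine mem_objective_iff.2 ⟨r, hi, by_contra fun hr => hr ?_⟩
    exact (sat_iff_winning_of_isRotatingStep hC hf (q := fun i => runState σ (μ i))
      (by rw [h0]; rfl) (fun i => (hμ i).step) (isDominant_of_isLeast he hi) hr).1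
      (sat_of_follows (by rw [h0]) hμ)

end FixpointStrategy

section GameStrategy

variable {p : N × Fin k} {σ : (elSystem e γ cpre).roundGame.Strategy p}

/-- The position of the fixpoint game at a memory state of `σ` and a record of the vertices visited
before. -/
def strategyState (σ : (elSystem e γ cpre).roundGame.Strategy p)
    (x : σ.Memory × List (ZVertex φ C)) : RunState N φ C :=
  ⟨(σ.pos x.1).1, e.symm (σ.pos x.1).2, x.2⟩

/-- A round of the fixpoint game that follows `σ` and in which the universal player rotates through
the children of the winning vertices. -/
def Rotates (σ : (elSystem e γ cpre).roundGame.Strategy p) (f : ZVertex φ C → ℕ → ZVertex φ C)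
    (x y : σ.Memory × List (ZVertex φ C)) : Prop :=
  σ.next x.1 y.1 ∧ IsRotatingStep γ f {s | s.Winning} (strategyState σ x) (strategyState σ y)

theorem exists_rotates_of_not_isLeaf (hf : IsChildRotation f) {x : σ.Memory × List (ZVertex φ C)}
    (hx : ¬ (strategyState σ x).vertex.IsLeaf) : ∃ y, Rotates σ f x y := by
  classical
  set s := (strategyState σ x).vertex
  obtain ⟨t, ht, hrot, m, hm, hpos⟩ : ∃ t ∈ s.children, (s.Winning → t = f s (x.2.count s)) ∧
      ((σ.pos x.1).1, e t) ∈ σ.pos '' {m | σ.next x.1 m} := by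
    by_cases hw : s.Winning
    · exact ⟨_, (hf s hx).1 _, fun _ => rfl,
        (mem_rhs_of_winning hx hw).1 (σ.forces x.1) _ ((hf s hx).1 _)⟩
    · obtain ⟨t, ht, hmem⟩ := (mem_rhs_of_losing hx hw).1 (σ.forces x.1)
      exact ⟨t, ht, fun h => (hw h).elim, hmem⟩
  have hvertex : (strategyState σ (m, s :: x.2)).vertex = t := by
    rw [strategyState, hpos, e.symm_apply_apply]
  refine ⟨(m, s :: x.2), hm, ⟨⟨fun _ => ⟨congrArg (·.1) hpos, ?_⟩, fun h => (hx h).elim⟩,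
    fun hw _ => ?_, rfl⟩⟩
  · rwa [hvertex]
  · rw [hvertex, hrot hw]
    rfl

theorem rotates_forces {x : σ.Memory × List (ZVertex φ C)}
    (hx : (strategyState σ x).vertex.IsLeaf) :
    (strategyState σ x).node ∈
      cpre ((fun y => (strategyState σ y).node) '' {y | Rotates σ f x y}) := by
  obtain ⟨s, hs, hanchor, hcpre⟩ := (mem_rhs_of_isLeaf hx).1 (σ.forces x.1)
  refine cpre.monotone ?_ hcpre
  rintro w ⟨m, hm, hpos⟩
  have hvertex : (strategyState σ (m, (strategyState σ x).vertex :: x.2)).vertex = s := by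
    rw [strategyState, hpos, e.symm_apply_apply]
  refine ⟨(m, (strategyState σ x).vertex :: x.2), ⟨hm, ⟨⟨fun h => (h hx).elim, fun _ => ?_⟩,
    fun _ h => (h hx).elim, rfl⟩⟩, congrArg Prod.fst hpos⟩
  rw [hvertex]
  exact ⟨hs, hanchor⟩

theorem sat_of_rotates [Finite (ZVertex φ C)] (hC : C.Finite) (hf : IsChildRotation f)
    (he : ∀ s t, s.Anc t → e s ≤ e t) {μ : ℕ → σ.Memory × List (ZVertex φ C)}
    (h0 : μ 0 = (σ.start, [])) (hμ : ∀ i, Rotates σ f (μ i) (μ (i + 1))) :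
    φ.Sat {c | ∃ᶠ n in atTop, c ∈ γ (strategyState σ
      (μ (Nat.nth (fun i => (strategyState σ (μ i)).vertex.IsLeaf) n))).node} := by
  obtain ⟨r, hr, hw⟩ := mem_objective_iff.1
    (σ.wins (fun i => (μ i).1) (by rw [h0]) fun i => (hμ i).1)
  have hdom : IsDominant (fun i => (strategyState σ (μ i)).vertex) r :=
    isDominant_of_isLeast he (by
      simpa only [strategyState, e.apply_symm_apply, Function.comp_apply] using hr)
  have hsat := (sat_iff_winning_of_isRotatingStep hC hf (q := fun i => strategyState σ (μ i))
    (by rw [h0]; rfl) (fun i => (hμ i).2) hdom hw).2 hw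
  have hrun : IsRun γ _ _ := fun i => (hμ i).2.toIsRunStep
  rwa [show {c | ∃ᶠ n in atTop, _} = _ from Set.ext fun c => frequently_apply_nth_iff
    (a := fun i => (strategyState σ (μ i)).node) hrun.frequently_isLeaf
    (fun i hi => ((hrun i).inner hi).1) fun v => c ∈ γ v]

theorem solution_subset_elGame_winningRegion (hC : C.Finite)
    (he : ∀ s t, s.Anc t → e s ≤ e t) (t : ZVertex φ C) :
    (elSystem e γ cpre).solution (e t) ⊆ (elGame φ γ cpre).winningRegion := by
  intro v hv
  obtain ⟨σ⟩ := FixSystem.mem_solution_iff.1 hv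
  have : Finite (ZVertex φ C) := .of_equiv _ e.symm
  obtain ⟨f, hf⟩ := exists_isChildRotation (φ := φ) (C := C)
  obtain ⟨B, hB⟩ := exists_depth_le (φ := φ) (C := C)
  refine ForcingGame.mem_winningRegion_of_stutteringStrategy
    ⟨σ.Memory × List (ZVertex φ C), fun x => (strategyState σ x).node, Rotates σ f, (σ.start, []),
      {x | (strategyState σ x).vertex.IsLeaf}, fun x => B - (strategyState σ x).vertex.depth,
      congrArg Prod.fst σ.pos_start, fun x hx => ?_, fun x => rotates_forces,
      fun μ => sat_of_rotates hC hf he⟩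
  obtain ⟨y, hy⟩ := exists_rotates_of_not_isLeaf hf hx
  obtain ⟨hnode, hchild⟩ := hy.2.inner hx
  have := depth_of_mem_children hchild
  have := hB (strategyState σ y).vertex
  exact ⟨y, hy, hnode, by omega⟩

end GameStrategy

theorem solution_eq_elGame_winningRegion (hC : C.Finite) (hγ : ∀ w, γ w ⊆ C)
    (he : ∀ s t, s.Anc t → e s ≤ e t) (t : ZVertex φ C) :
    (elSystem e γ cpre).solution (e t) = (elGame φ γ cpre).winningRegion :=
  Set.Subset.antisymm (solution_subset_elGame_winningRegion hC he t)
    (elGame_winningRegion_subset hC hγ he t)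

end ELSystem

theorem mainTheorem7_general {Var : Type*} (G : SymbolicGame Var) (φ : ELFormula (BForm Var))
    (hwin : ∀ w : ℕ → Var → Bool, G.win.Sat w 0 ↔ (elToLTL φ).Sat w 0) {C : Set (BForm Var)}
    (hC : C.Finite) (hφ : boolSubformulas φ ⊆ C) {k : ℕ} (e : ZVertex φ C ≃ Fin k)
    (he : ∀ s t, s.Anc t → e s ≤ e t) (t : ZVertex φ C) :
    (elSystem e (coloring C) G.cpre).solution (e t) = G.winningRegion := by
  rw [SymbolicGame.winningRegion_eq_roundGame, SymbolicGame.roundGame_eq_elGame hφ hwin]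
  exact ELSystem.solution_eq_elGame_winningRegion hC (fun _ _ hψ => hψ.1) he t

theorem mainTheorem7 {Var : Type*} [Finite Var] (G : SymbolicGame Var)
    (φ : ELFormula (BForm Var))
    (hwin : ∀ w : ℕ → Var → Bool, G.win.Sat w 0 ↔ (elToLTL φ).Sat w 0)
    {k : ℕ} (e : ZVertex φ (boolSubformulas φ) ≃ Fin k)
    (he : ∀ s t, s.Anc t → e s ≤ e t) :
    (elSystem e (coloring (boolSubformulas φ)) G.cpre).solution
      (e (ZVertex.root φ (boolSubformulas φ))) = G.winningRegion :=
  mainTheorem7_general G φ hwin (boolSubformulas_finite φ) subset_rfl e he _
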